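/- Let $R$ be a unital ring, let $L$ be a right $R$-module of projective dimension at most $1$, let $K$ be a finitely presented submodule of $L$, and put $M=L/K$. Then the following are equivalent: (1) $\operatorname{Ext}^1_R(M,-)$ preserves direct sums of copies of $R$, i.e. for every set $I$ the natural homomorphism $\operatorname{Ext}^1_R(M,R)^{(I)}\to\operatorname{Ext}^1_R(M,R^{(I)})$, induced by the maps $\operatorname{Ext}^1_R(M,u_i)$ where $u_i:R\to R^{(I)}$ ($i\in I$) are the canonical injections, is an isomorphism; (2) $M$ is an fp-$\Omega^1$-module, i.e. $M$ has a projective resolution $\cdots\to P_2\to P_1\xrightarrow{\alpha_1}P_0\to M\to 0$ whose first syzygy $\operatorname{Im}(\alpha_1)$ is finitely presented. -/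

import Mathlib

open CategoryTheory CategoryTheory.Abelian

universe u

noncomputable section

namespace ExtSums

variable {S : Type u} [Ring S]

/-- The direct sum of a family of modules, as an object of the module category. -/
def dirSum {I : Type u} (X : I → ModuleCat.{u} S) : ModuleCat.{u} S :=
  ModuleCat.of S (DirectSum I fun i => X i)

open Classical in
/-- The canonical homomorphism from `X i` into the direct sum of the family `X`. -/
def dirSumIncl {I : Type u} (X : I → ModuleCat.{u} S) (i : I) : X i ⟶ dirSum X :=
  ModuleCat.ofHom (DirectSum.lof S I (fun i => X i) i)

open Classical in
/-- The natural homomorphism `⨁ i, Ext^n (M, X i) → Ext^n (M, ⨁ i, X i)`, induced by the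
maps `Ext^n (M, u_i)`, where `u_i` is the canonical homomorphism `X i → ⨁ i, X i`. -/
def extDirSumHom (n : ℕ) (M : ModuleCat.{u} S) {I : Type u} (X : I → ModuleCat.{u} S) :
    (DirectSum I fun i => Ext M (X i) n) →+ Ext M (dirSum X) n :=
  DirectSum.toAddMonoid fun i =>
    (Ext.mk₀ (dirSumIncl X i)).postcomp M (add_zero n)

/-- `Ext^1 (M, -)` preserves direct sums of copies of `N`: for every set `I`, the natural
homomorphism `Ext^1 (M, N)^(I) → Ext^1 (M, N^(I))` is an isomorphism. -/
def ExtOnePreservesSumsOfCopies (M N : ModuleCat.{u} S) : Prop :=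
  ∀ I : Type u, Function.Bijective (extDirSumHom 1 M fun _ : I => N)

/-- `M` is an fp-Ω¹-module: it has a projective resolution `⋯ → P₂ → P₁ → P₀ → M → 0` whose
first syzygy, the image of `P₁ → P₀`, is finitely presented. -/
def IsFpOmegaOne (M : ModuleCat.{u} S) : Prop :=
  ∃ P : ProjectiveResolution M,
    Module.FinitePresentation S (LinearMap.range (P.complex.d 1 0).hom)

end ExtSums

end

/-! Write `S` for `Rᵐᵒᵖ`. If the first syzygy is finitely generated, a map from it into a direct sum
lands in a finite subsum, so `Ext^1` preserves sums. Conversely, since `L` has projective dimension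
at most 1, there is an exact sequence `0 → S^(I) → P → L → 0` with `P` projective
(`exists_projective_surjective_exact_finsupp`). Put `N = π⁻¹(K)`, the kernel of `P → L/K`. As `K`
has finitely many relations, the coordinates on `S^(I)` extend to `N` off a finite set
(`exists_extend_coord_off_finset`); by (1) they extend to `P` after discarding finitely many more.
So almost all of `S^(I)` splits off `P`. The complement `P'` still maps onto `L/K`, with kernel `P'
∩ N` an extension of `K` by a finite free module. -/

section

variable {S : Type u} [Ring S]

/-! ### Splitting off almost all coordinates of a free submodule -/

/-- If the submodule `K` is finitely presented and the kernel of `π` is free on `I`, then the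
coordinate map on the kernel extends to `π⁻¹(K)`, up to finitely many coordinates. -/
theorem exists_extend_coord_off_finset {P L I : Type u} [AddCommGroup P] [Module S P]
    [AddCommGroup L] [Module S L] (j : (I →₀ S) →ₗ[S] P) (π : P →ₗ[S] L)
    (hj : Function.Injective j) (hex : Function.Exact j π) (hπ : Function.Surjective π)
    (K : Submodule S L) [hK : Module.FinitePresentation S K] :
    ∃ (f : K.comap π →ₗ[S] (I →₀ S)) (s : Finset I),
      ∀ (x : K.comap π) (y : I →₀ S), j y = x → ∀ i ∉ s, f x i = y i := by
  classical
  obtain ⟨n, φ, hφ⟩ := Module.Finite.exists_fin' S K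
  obtain ⟨ψ, hψ⟩ := Module.projective_lifting_property π (K.subtype ∘ₗ φ) hπ
  have hψ' : ∀ x, π (ψ x) = φ x := fun x => LinearMap.congr_fun hψ x
  have hker : (LinearMap.ker φ).FG := Module.FinitePresentation.fg_ker φ hφ
  obtain ⟨T, hT⟩ := hker
  have hTker : ∀ x ∈ T, φ x = 0 := fun x hx => by
    have : x ∈ LinearMap.ker φ := hT ▸ Submodule.subset_span hx
    exact this
  have hlift : ∀ x, φ x = 0 → ∃ y, j y = ψ x := fun x hx =>
    (hex _).1 (by rw [hψ', hx]; rfl)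
  choose! lft hlft using hlift
  -- The finitely many relations of `K` lift to elements of `S^(I)`; `s` collects their supports.
  let s : Finset I := T.biUnion fun x => (lft x).support
  have hs : ∀ x, φ x = 0 → ∀ y, j y = ψ x → ∀ i ∉ s, y i = 0 := by
    have key : LinearMap.ker φ ≤
        ((Finsupp.supported S S (s : Set I)).map j).comap ψ := by
      rw [← hT, Submodule.span_le]
      intro x hx
      refine ⟨lft x, ?_, hlft x (hTker x hx)⟩
      intro i hi
      exact Finset.mem_biUnion.2 ⟨x, hx, hi⟩
    intro x hx y hy i hi
    obtain ⟨y', hy', e⟩ := key hx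
    have : y = y' := hj (hy.trans e.symm)
    subst this
    by_contra h
    exact hi (hy' (Finsupp.mem_support_iff.2 h))
  let ρ : (I →₀ S) →ₗ[S] (I →₀ S) :=
    (Finsupp.supported S S ((s : Set I)ᶜ)).subtype ∘ₗ Finsupp.restrictDom S S ((s : Set I)ᶜ)
  have hρ : ∀ y : I →₀ S, ∀ i, ρ y i = if i ∉ s then y i else 0 := by
    intro y i
    simp [ρ, Finsupp.restrictDom_apply, Finsupp.filter_apply]
  -- `Φ` presents `π⁻¹(K)`. The map `(y, x) ↦ ρ y` descends along it: if `j y + ψ x = 0`, then `x`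
  -- is a relation of `K`, so `y` is supported in `s`.
  let Φ : (I →₀ S) × (Fin n → S) →ₗ[S] K.comap π :=
    LinearMap.codRestrict _ (j.coprod ψ) (by
      intro x
      have : π (j x.1) = 0 := (hex _).2 ⟨_, rfl⟩
      simp [this, hψ'])
  have hΦ : ∀ y x, (Φ (y, x) : P) = j y + ψ x := fun y x => rfl
  have hΦs : Function.Surjective Φ := by
    rintro ⟨z, hz⟩
    obtain ⟨x, hx⟩ := hφ ⟨π z, hz⟩
    obtain ⟨y, hy⟩ := (hex (z - ψ x)).1 (by rw [map_sub, hψ', hx, sub_self])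
    exact ⟨(y, x), Subtype.ext (by rw [hΦ, hy]; simp)⟩
  have hle : LinearMap.ker Φ ≤ LinearMap.ker (ρ ∘ₗ LinearMap.fst S _ _) := by
    rintro ⟨y, x⟩ h
    have h0 : j y + ψ x = 0 := by rw [← hΦ, LinearMap.mem_ker.1 h]; rfl
    have hx : φ x = 0 := by
      have h1 := congrArg π h0
      rw [map_add, (hex _).2 ⟨_, rfl⟩, hψ', zero_add, map_zero] at h1
      exact Subtype.ext h1
    have h2 := hs x hx (-y) (by rw [map_neg]; exact neg_eq_of_add_eq_zero_right h0)
    ext i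
    simp only [LinearMap.comp_apply, LinearMap.fst_apply, hρ]
    split_ifs with hi
    · rfl
    · simpa using h2 i hi
  let f := (LinearMap.ker Φ).liftQ _ hle ∘ₗ (Φ.quotKerEquivOfSurjective hΦs).symm.toLinearMap
  have hf : ∀ w, f (Φ w) = ρ w.1 := by
    intro w
    have : (Φ.quotKerEquivOfSurjective hΦs).symm (Φ w) = Submodule.Quotient.mk w := by
      rw [LinearEquiv.symm_apply_eq]; rfl
    simp only [f, LinearMap.comp_apply, LinearEquiv.coe_coe, this]
    rfl
  refine ⟨f, s, fun x y hxy i hi => ?_⟩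
  have : x = Φ (y, 0) := Subtype.ext (by rw [hΦ, hxy]; simp)
  rw [this, hf, hρ, if_pos hi]

/-- If a homomorphism `g` splits `j` off finitely many coordinates, then `P` may be replaced by a
projective submodule `P'` with `P' + π⁻¹(K) = P` and `P' ∩ π⁻¹(K)` finitely presented. -/
theorem exists_projective_sup_eq_top_inf_finitePresentation {P L I : Type u}
    [AddCommGroup P] [Module S P] [Module.Projective S P]
    [AddCommGroup L] [Module S L] (j : (I →₀ S) →ₗ[S] P) (π : P →ₗ[S] L)
    (hj : Function.Injective j) (hex : Function.Exact j π) (hπ : Function.Surjective π)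
    (K : Submodule S L) [hK : Module.FinitePresentation S K]
    (g : P →ₗ[S] (I →₀ S)) (s : Finset I) (hg : ∀ y, ∀ i ∉ s, g (j y) i = y i) :
    ∃ P' : Submodule S P, Module.Projective S P' ∧
      (∀ x, ∃ z ∈ P', x - z ∈ K.comap π) ∧
      Module.FinitePresentation S ((K.comap π).comap P'.subtype) := by
  classical
  let ρ : (I →₀ S) →ₗ[S] (I →₀ S) :=
    (Finsupp.supported S S ((s : Set I)ᶜ)).subtype ∘ₗ Finsupp.restrictDom S S ((s : Set I)ᶜ)
  have hρ : ∀ y : I →₀ S, ∀ i, ρ y i = if i ∉ s then y i else 0 := by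
    intro y i
    simp [ρ, Finsupp.restrictDom_apply, Finsupp.filter_apply]
  let P' := LinearMap.ker (ρ ∘ₗ g)
  have hP' : ∀ x, x ∈ P' ↔ ∀ i ∉ s, g x i = 0 := by
    intro x
    simp only [P', LinearMap.mem_ker, LinearMap.comp_apply, Finsupp.ext_iff, hρ]
    simp
  have hπj : ∀ y, π (j y) = 0 := fun y => (hex _).2 ⟨y, rfl⟩
  -- Since `ρ ∘ g ∘ j = ρ`, the map `j ∘ ρ ∘ g` is idempotent; `r` is the complementary projection.
  let r : P →ₗ[S] P' := LinearMap.codRestrict P' (LinearMap.id - j ∘ₗ ρ ∘ₗ g) (by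
    intro x
    rw [hP']
    intro i hi
    simp [hg _ i hi, hρ, hi])
  have hr : ∀ x, (r x : P) = x - j (ρ (g x)) := fun x => rfl
  refine ⟨P', ?_, fun x => ⟨r x, (r x).2, ?_⟩, ?_⟩
  · refine Module.Projective.of_split P'.subtype r ?_
    ext x
    have : ρ (g x) = 0 := x.2
    simp [hr, this]
  · rw [hr]; simp [hπj]
  · let N' := (K.comap π).comap P'.subtype
    let q : N' →ₗ[S] K := LinearMap.codRestrict K (π ∘ₗ P'.subtype ∘ₗ N'.subtype) fun x => x.2
    have hq : ∀ x, (q x : L) = π x.1.1 := fun x => rfl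
    have hqs : Function.Surjective q := by
      rintro ⟨k, hk⟩
      obtain ⟨x, rfl⟩ := hπ k
      have e : π (r x) = π x := by rw [hr]; simp [hπj]
      exact ⟨⟨r x, by change π (r x) ∈ K; rwa [e]⟩, Subtype.ext e⟩
    have hmem : ∀ y ∈ Finsupp.supported S S (s : Set I), j y ∈ P' := by
      intro y hy
      rw [hP']
      intro i hi
      rw [hg y i hi]
      by_contra h
      exact hi (hy (Finsupp.mem_support_iff.2 h))
    -- The kernel of `P' ∩ π⁻¹(K) → K` is the image under `j` of the free module on the finite set
    -- `s`.
    let t : Finsupp.supported S S (s : Set I) →ₗ[S] LinearMap.ker q :=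
      LinearMap.codRestrict _ (LinearMap.codRestrict N' (LinearMap.codRestrict P'
        (j ∘ₗ Submodule.subtype _) fun y => hmem y y.2)
        fun y => by change π (j y) ∈ K; rw [hπj]; exact K.zero_mem)
        fun y => Subtype.ext (hπj y)
    have ht : ∀ y, ((t y).1.1.1 : P) = j y := fun y => rfl
    have htb : Function.Bijective t := by
      constructor
      · intro a b hab
        have : j a = j b := by rw [← ht, ← ht, hab]
        exact Subtype.ext (hj this)
      · rintro ⟨⟨⟨x, hx⟩, hxN⟩, hxk⟩
        obtain ⟨y, hy⟩ := (hex x).1 (congrArg Subtype.val hxk)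
        refine ⟨⟨y, ?_⟩, Subtype.ext (Subtype.ext (Subtype.ext hy))⟩
        intro i hi
        by_contra h
        have h1 := (hP' x).1 hx i h
        rw [← hy, hg y i h] at h1
        exact Finsupp.mem_support_iff.1 hi h1
    let e : (s →₀ S) ≃ₗ[S] LinearMap.ker q :=
      (Finsupp.supportedEquivFinsupp (M := S) (R := S) (s : Set I)).symm ≪≫ₗ
        LinearEquiv.ofBijective t htb
    have : Module.FinitePresentation S (LinearMap.ker q) :=
      Module.FinitePresentation.of_equiv (R := S) (M := s →₀ S) (N := LinearMap.ker q) e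
    exact Module.finitePresentation_of_ker q hqs

/-- A quotient of a projective module by a projective submodule is also a quotient of a projective
module by a free submodule. -/
theorem exists_projective_surjective_exact_finsupp {P L : Type u}
    [AddCommGroup P] [Module S P] [Module.Projective S P] [AddCommGroup L] [Module S L]
    (π : P →ₗ[S] L) (hπ : Function.Surjective π) [Module.Projective S (LinearMap.ker π)] :
    ∃ (P' : Type u) (_ : AddCommGroup P') (_ : Module S P') (_ : Module.Projective S P')
      (I : Type u) (j : (I →₀ S) →ₗ[S] P') (π' : P' →ₗ[S] L),
      Function.Injective j ∧ Function.Exact j π' ∧ Function.Surjective π' := by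
  -- Here `S^(Q) ≃ Q ⊕ ker r`, so adding the projective module `ker r` to `P` makes the kernel free.
  let Q := LinearMap.ker π
  obtain ⟨c, hc⟩ := (inferInstance : Module.Projective S Q).out
  let r : (Q →₀ S) →ₗ[S] Q := Finsupp.linearCombination S id
  have hrc : ∀ q, r (c q) = q := hc
  let h : (Q →₀ S) →ₗ[S] LinearMap.ker r := LinearMap.codRestrict _ (LinearMap.id - c ∘ₗ r)
    (fun y => by simp [hrc])
  have hh : ∀ y, (h y : Q →₀ S) = y - c (r y) := fun y => rfl
  have : Module.Projective S (LinearMap.ker r) := by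
    refine Module.Projective.of_split (Submodule.subtype _) h ?_
    ext1 x
    have : r x = 0 := x.2
    exact Subtype.ext (by simp [hh, this])
  refine ⟨P × LinearMap.ker r, inferInstance, inferInstance, inferInstance, Q,
    (Q.subtype ∘ₗ r).prod h, π ∘ₗ LinearMap.fst S _ _, ?_, ?_, ?_⟩
  · refine (injective_iff_map_eq_zero _).2 fun y hy => ?_
    have h1 : r y = 0 := Subtype.ext (congrArg Prod.fst hy)
    have h2 : (h y : Q →₀ S) = 0 := congrArg (fun z => (z.2 : Q →₀ S)) hy
    rwa [hh, h1, map_zero, sub_zero] at h2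
  · rintro ⟨p, k⟩
    constructor
    · intro hp
      have hk : r k = 0 := k.2
      refine ⟨c ⟨p, hp⟩ + k, Prod.ext ?_ (Subtype.ext ?_)⟩
      · simp [hrc, hk]
      · change (h _ : Q →₀ S) = _
        simp [hh, hrc, hk]
    · rintro ⟨y, hy⟩
      have : (r y : P) = p := congrArg Prod.fst hy
      change π p = 0
      rw [← this]
      exact (r y).2
  · intro l
    obtain ⟨p, rfl⟩ := hπ l
    exact ⟨(p, 0), rfl⟩

namespace ExtSums

/-! ### The natural map on `Ext` of a direct sum -/

/-- The projection of a direct sum onto one of its factors. -/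
noncomputable def dirSumProj {I : Type u} (X : I → ModuleCat.{u} S) (i : I) : dirSum X ⟶ X i :=
  ModuleCat.ofHom (DirectSum.component S I (fun i => X i) i)

theorem dirSumIncl_comp_dirSumProj_self {I : Type u} (X : I → ModuleCat.{u} S) (i : I) :
    dirSumIncl X i ≫ dirSumProj X i = 𝟙 _ := by
  classical
  ext x
  change DirectSum.component S I (fun i => X i) i (DirectSum.lof S I (fun i => X i) i x) = x
  exact DirectSum.component.lof_self (R := S) (M := fun i => X i) (i := i) x

theorem dirSumIncl_comp_dirSumProj_of_ne {I : Type u} (X : I → ModuleCat.{u} S) {i k : I}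
    (h : i ≠ k) : dirSumIncl X i ≫ dirSumProj X k = 0 := by
  classical
  ext x
  change DirectSum.component S I (fun i => X i) k (DirectSum.lof S I (fun i => X i) i x) = 0
  rw [DirectSum.component.of]
  exact dif_neg h

open Classical in
theorem extDirSumHom_of (n : ℕ) (M : ModuleCat.{u} S) {I : Type u} (X : I → ModuleCat.{u} S)
    (i : I) (e : Ext M (X i) n) :
    extDirSumHom n M X (DirectSum.of (fun i => Ext M (X i) n) i e) =
      e.comp (Ext.mk₀ (dirSumIncl X i)) (add_zero n) := by
  rw [extDirSumHom]
  convert DirectSum.toAddMonoid_of (β := fun i => Ext M (X i) n) _ i e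
  rfl

theorem extDirSumHom_comp_dirSumProj (n : ℕ) (M : ModuleCat.{u} S) {I : Type u}
    (X : I → ModuleCat.{u} S) (y : DirectSum I fun i => Ext M (X i) n) (k : I) :
    (extDirSumHom n M X y).comp (Ext.mk₀ (dirSumProj X k)) (add_zero n) = y k := by
  classical
  induction y using DirectSum.induction_on with
  | zero => simp
  | add a b ha hb => rw [map_add, Ext.add_comp, ha, hb, DirectSum.add_apply]
  | of i e =>
    rw [extDirSumHom_of, Ext.comp_assoc_of_third_deg_zero, Ext.mk₀_comp_mk₀]
    by_cases h : i = k
    · subst h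
      rw [dirSumIncl_comp_dirSumProj_self, Ext.comp_mk₀_id, DirectSum.of_eq_same]
    · rw [dirSumIncl_comp_dirSumProj_of_ne X h, Ext.mk₀_zero, Ext.comp_zero,
        DirectSum.of_eq_of_ne _ _ _ (Ne.symm h)]

/-- The projections recover every component, so only surjectivity is ever at stake. -/
theorem extDirSumHom_injective (n : ℕ) (M : ModuleCat.{u} S) {I : Type u}
    (X : I → ModuleCat.{u} S) : Function.Injective (extDirSumHom n M X) := by
  intro a b h
  refine DFinsupp.ext fun k => ?_
  have := extDirSumHom_comp_dirSumProj n M X a k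
  rw [h, extDirSumHom_comp_dirSumProj] at this
  exact this.symm

/-! ### Degree-one classes as homomorphisms on a syzygy -/

variable {T : ShortComplex (ModuleCat.{u} S)} (hT : T.ShortExact)

/-- The connecting map is onto because `Ext^1` vanishes on the projective middle term. -/
theorem exists_hom_of_ext (hT : T.ShortExact) [Projective T.X₂] (Y : ModuleCat.{u} S) (e : Ext T.X₃ Y 1) :
    ∃ f : T.X₁ ⟶ Y, hT.extClass.comp (Ext.mk₀ f) (add_zero 1) = e := by
  obtain ⟨x, hx⟩ := Ext.contravariant_sequence_exact₃ hT Y e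
    (Ext.eq_zero_of_projective _) (add_zero 1)
  obtain ⟨f, rfl⟩ := Ext.addEquiv₀.symm.surjective x
  exact ⟨f, hx⟩

theorem exists_extension_of_extClass_comp_eq {Y : ModuleCat.{u} S} (f f' : T.X₁ ⟶ Y)
    (h : hT.extClass.comp (Ext.mk₀ f) (add_zero 1) =
      hT.extClass.comp (Ext.mk₀ f') (add_zero 1)) :
    ∃ g : T.X₂ ⟶ Y, T.f ≫ g = f - f' := by
  obtain ⟨x, hx⟩ := Ext.contravariant_sequence_exact₁ hT Y (Ext.mk₀ (f - f')) (add_zero 1) (by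
    rw [sub_eq_add_neg, Ext.mk₀_add, Ext.mk₀_neg, Ext.comp_add, Ext.comp_neg, h,
      add_neg_cancel])
  obtain ⟨g, rfl⟩ := Ext.addEquiv₀.symm.surjective x
  refine ⟨g, Ext.addEquiv₀.symm.injective ?_⟩
  refine Eq.trans ?_ hx
  exact (Ext.mk₀_comp_mk₀ _ _).symm

/-- A class in the image of `extDirSumHom` is represented by a homomorphism with values in a
finite subsum. -/
theorem exists_finset_hom_of_extDirSumHom [Projective T.X₂] {I : Type u}
    (X : I → ModuleCat.{u} S) (y : DirectSum I fun i => Ext T.X₃ (X i) 1) :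
    ∃ (h : T.X₁ ⟶ dirSum X) (s : Finset I), (∀ k ∉ s, h ≫ dirSumProj X k = 0) ∧
      hT.extClass.comp (Ext.mk₀ h) (add_zero 1) = extDirSumHom 1 T.X₃ X y := by
  classical
  induction y using DirectSum.induction_on with
  | zero => exact ⟨0, ∅, by simp, by simp⟩
  | of i e =>
    obtain ⟨f, rfl⟩ := exists_hom_of_ext hT _ e
    refine ⟨f ≫ dirSumIncl X i, {i}, fun k hk => ?_, ?_⟩
    · rw [Category.assoc, dirSumIncl_comp_dirSumProj_of_ne X (by simpa [eq_comm] using hk),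
        Limits.comp_zero]
    · rw [extDirSumHom_of, Ext.comp_assoc_of_third_deg_zero, Ext.mk₀_comp_mk₀]
  | add a b ha hb =>
    obtain ⟨h, s, hs, e⟩ := ha
    obtain ⟨h', s', hs', e'⟩ := hb
    refine ⟨h + h', s ∪ s', fun k hk => ?_, ?_⟩
    · rw [Finset.mem_union, not_or] at hk
      rw [Preadditive.add_comp, hs k hk.1, hs' k hk.2, add_zero]
    · rw [Ext.mk₀_add, Ext.comp_add, e, e', map_add]

theorem hom_eq_sum_of_comp_dirSumProj_eq_zero {N : ModuleCat.{u} S} {I : Type u}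
    (X : I → ModuleCat.{u} S) (f : N ⟶ dirSum X) (s : Finset I)
    (hs : ∀ k ∉ s, f ≫ dirSumProj X k = 0) :
    f = ∑ i ∈ s, (f ≫ dirSumProj X i) ≫ dirSumIncl X i := by
  classical
  have key : ∀ k, f ≫ dirSumProj X k =
      (∑ i ∈ s, (f ≫ dirSumProj X i) ≫ dirSumIncl X i) ≫ dirSumProj X k := by
    intro k
    rw [Preadditive.sum_comp]
    by_cases hk : k ∈ s
    · rw [Finset.sum_eq_single_of_mem k hk, Category.assoc, dirSumIncl_comp_dirSumProj_self,
        Category.comp_id]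
      intro i _ hi
      rw [Category.assoc, dirSumIncl_comp_dirSumProj_of_ne X hi, Limits.comp_zero]
    · rw [hs k hk, Finset.sum_eq_zero]
      intro i hi
      have : i ≠ k := fun h => hk (h ▸ hi)
      rw [Category.assoc, dirSumIncl_comp_dirSumProj_of_ne X this, Limits.comp_zero]
  ext x
  exact DFinsupp.ext fun k => congrArg (fun φ => φ.hom x) (key k)

theorem exists_finset_comp_dirSumProj_eq_zero {N : ModuleCat.{u} S} [Module.Finite S N]
    {I : Type u} (X : I → ModuleCat.{u} S) (f : N ⟶ dirSum X) :
    ∃ s : Finset I, ∀ k ∉ s, f ≫ dirSumProj X k = 0 := by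
  classical
  obtain ⟨t, ht⟩ := (inferInstance : Module.Finite S N).fg_top
  refine ⟨t.biUnion fun x => DFinsupp.support (f.hom x : DirectSum I fun i => X i),
    fun k hk => ?_⟩
  ext1
  refine LinearMap.ext_on ht fun x hx => ?_
  by_contra h
  exact hk (Finset.mem_biUnion.2 ⟨x, hx, DFinsupp.mem_support_iff.2 h⟩)

/-- A class comes from a homomorphism on the finitely generated `T.X₁`, which is a finite sum of
homomorphisms into single factors. -/
theorem extDirSumHom_one_bijective_of_finite [Projective T.X₂] (hT : T.ShortExact)
    [Module.Finite S T.X₁] {I : Type u} (X : I → ModuleCat.{u} S) :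
    Function.Bijective (extDirSumHom 1 T.X₃ X) := by
  classical
  refine ⟨extDirSumHom_injective 1 _ X, fun e => ?_⟩
  obtain ⟨f, rfl⟩ := exists_hom_of_ext hT _ e
  obtain ⟨s, hs⟩ := exists_finset_comp_dirSumProj_eq_zero X f
  refine ⟨∑ i ∈ s, DirectSum.of (fun i => Ext T.X₃ (X i) 1) i
    (hT.extClass.comp (Ext.mk₀ (f ≫ dirSumProj X i)) (add_zero 1)), ?_⟩
  conv_rhs => rw [hom_eq_sum_of_comp_dirSumProj_eq_zero X f s hs]
  have hmk : Ext.mk₀ (∑ i ∈ s, (f ≫ dirSumProj X i) ≫ dirSumIncl X i) =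
      ∑ i ∈ s, Ext.mk₀ ((f ≫ dirSumProj X i) ≫ dirSumIncl X i) :=
    map_sum Ext.addEquiv₀.symm _ _
  have hcomp := map_sum (hT.extClass.precomp (dirSum X) (add_zero 1))
    (fun i => Ext.mk₀ ((f ≫ dirSumProj X i) ≫ dirSumIncl X i)) s
  rw [hmk, map_sum]
  refine Eq.trans (Finset.sum_congr rfl fun i _ => ?_) hcomp.symm
  rw [extDirSumHom_of, Ext.comp_assoc_of_third_deg_zero, Ext.mk₀_comp_mk₀]
  rfl

/-- An fp-Ω¹-module has the property that `Ext^1` preserves arbitrary direct sums. -/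
theorem IsFpOmegaOne.extDirSumHom_one_bijective {M : ModuleCat.{u} S} (h : IsFpOmegaOne M)
    {I : Type u} (X : I → ModuleCat.{u} S) : Function.Bijective (extDirSumHom 1 M X) := by
  obtain ⟨P, hP⟩ := h
  have hπ : Function.Surjective (P.π.f 0).hom :=
    (ModuleCat.epi_iff_surjective _).1 inferInstance
  have hex : Function.Exact (P.complex.d 1 0).hom (P.π.f 0).hom :=
    (ShortComplex.ShortExact.moduleCat_exact_iff_function_exact _).1 P.exact₀
  have hker : LinearMap.ker (P.π.f 0).hom = LinearMap.range (P.complex.d 1 0).hom :=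
    LinearMap.exact_iff.1 hex
  have hT := LinearMap.shortExact_shortComplexKer hπ
  rw [← hker] at hP
  have : Projective (P.π.f 0).hom.shortComplexKer.X₂ := P.projective 0
  have : Module.Finite S (P.π.f 0).hom.shortComplexKer.X₁ :=
    inferInstanceAs (Module.Finite S (LinearMap.ker (P.π.f 0).hom))
  exact extDirSumHom_one_bijective_of_finite hT X

/-! ### From a projective presentation to a resolution -/

/-- A projective presentation whose kernel is finitely presented can be continued to a projective
resolution by splicing it with a resolution of the kernel. -/
theorem isFpOmegaOne_of_surjective {P : Type u} [AddCommGroup P] [Module S P]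
    [Module.Projective S P] {M : ModuleCat.{u} S} (π : P →ₗ[S] M) (hπ : Function.Surjective π)
    [hfp : Module.FinitePresentation S (LinearMap.ker π)] : IsFpOmegaOne M := by
  let Q : ProjectiveResolution (ModuleCat.of S (LinearMap.ker π)) := ProjectiveResolution.of _
  let q : Q.complex.X 0 ⟶ ModuleCat.of S (LinearMap.ker π) := Q.π.f 0
  have hqs : Function.Surjective q.hom :=
    (ModuleCat.epi_iff_surjective _).1 (inferInstanceAs (Epi (Q.π.f 0)))
  have hq0 : Q.complex.d 1 0 ≫ q = 0 := Q.complex_d_comp_π_f_zero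
  have hqex : Function.Exact (Q.complex.d 1 0).hom q.hom :=
    (ShortComplex.ShortExact.moduleCat_exact_iff_function_exact _).1 Q.exact₀
  let ι : ModuleCat.of S (LinearMap.ker π) ⟶ ModuleCat.of S P :=
    ModuleCat.ofHom (LinearMap.ker π).subtype
  let D : ChainComplex (ModuleCat.{u} S) ℕ := Q.complex.augment (q ≫ ι)
    (by rw [reassoc_of% hq0, Limits.zero_comp])
  have hrange : LinearMap.range (D.d 1 0).hom = LinearMap.ker π := by
    change LinearMap.range ((LinearMap.ker π).subtype ∘ₗ q.hom) = _
    rw [LinearMap.range_comp, LinearMap.range_eq_top.2 hqs, Submodule.map_top,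
      Submodule.range_subtype]
  have hdπ : D.d 1 0 ≫ ModuleCat.ofHom π = 0 := by
    ext x
    exact (q.hom x).2
  have hex0 : (ShortComplex.mk (D.d 1 0) (ModuleCat.ofHom π) hdπ).Exact :=
    (ShortComplex.ShortExact.moduleCat_exact_iff_function_exact _).2
      (LinearMap.exact_iff.2 hrange.symm)
  have hex1 : ∀ n, D.ExactAt (n + 1) := by
    intro n
    rw [HomologicalComplex.exactAt_iff' _ (n + 1 + 1) (n + 1) n (by simp) (by simp)]
    refine (ShortComplex.ShortExact.moduleCat_exact_iff_function_exact _).2 ?_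
    -- Only degree 1 sees the new differential `q ≫ ι`; as `ι` is injective, its kernel is that of
    -- `q`.
    match n with
    | 0 =>
      intro x
      refine Iff.trans ?_ (hqex x)
      exact ⟨fun h => Subtype.ext h, fun h => congrArg Subtype.val h⟩
    | n + 1 =>
      exact (ShortComplex.ShortExact.moduleCat_exact_iff_function_exact _).1 (Q.exact_succ n)
  have hproj : ∀ n, Projective (D.X n) := by
    intro n
    match n with
    | 0 => exact (IsProjective.iff_projective P).1 inferInstance
    | n + 1 => exact Q.projective n
  have : Epi (ModuleCat.ofHom π) := (ModuleCat.epi_iff_surjective _).2 hπ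
  let p : D ⟶ (ChainComplex.single₀ (ModuleCat.{u} S)).obj M :=
    (ChainComplex.toSingle₀Equiv _ _).symm ⟨ModuleCat.ofHom π, hdπ⟩
  have hquasi : QuasiIso p := ⟨fun n => by
    match n with
    | 0 =>
      rw [ChainComplex.quasiIsoAt₀_iff, ShortComplex.quasiIso_iff_of_zeros']
      · refine (ShortComplex.exact_and_epi_g_iff_of_iso ?_).2 ⟨hex0, this⟩
        exact ShortComplex.isoMk (Iso.refl _) (Iso.refl _) (Iso.refl _) rfl rfl
      all_goals rfl
    | n + 1 =>
      rw [quasiIsoAt_iff_exactAt']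
      · exact hex1 n
      · apply ChainComplex.exactAt_succ_single_obj⟩
  refine ⟨{ complex := D, projective := hproj, π := p, quasiIso := hquasi }, ?_⟩
  change Module.FinitePresentation S (LinearMap.range (D.d 1 0).hom)
  rw [hrange]
  exact hfp

/-! ### From preservation of sums to a finitely presented syzygy -/

/-- If `Ext^1 (M, -)` preserves sums of copies of `A ≅ S` and `N → P → M` is a projective
presentation, then homomorphisms `N → S^(I)` extend to `P` off finitely many coordinates. -/
theorem ExtOnePreservesSumsOfCopies.exists_extend_off_finset {M A : ModuleCat.{u} S}
    (h : ExtOnePreservesSumsOfCopies M A) (a : A ≃ₗ[S] S)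
    {P : Type u} [AddCommGroup P] [Module S P] [Module.Projective S P]
    (p : P →ₗ[S] M) (hp : Function.Surjective p) {I : Type u}
    (f : LinearMap.ker p →ₗ[S] (I →₀ S)) :
    ∃ (g : P →ₗ[S] (I →₀ S)) (s : Finset I),
      ∀ (x : LinearMap.ker p), ∀ i ∉ s, g x i = f x i := by
  classical
  have hT := LinearMap.shortExact_shortComplexKer hp
  have : Projective p.shortComplexKer.X₂ := (IsProjective.iff_projective P).1 inferInstance
  let e : (I →₀ S) ≃ₗ[S] DirectSum I fun _ => A :=
    Finsupp.mapRange.linearEquiv a.symm ≪≫ₗ finsuppLEquivDirectSum S A I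
  have he : ∀ y i, a (e y i) = y i := fun y i => a.apply_symm_apply (y i)
  let f' : p.shortComplexKer.X₁ ⟶ dirSum fun _ : I => A :=
    ModuleCat.ofHom (e.toLinearMap ∘ₗ f)
  obtain ⟨y, hy⟩ := (h I).2 (hT.extClass.comp (Ext.mk₀ f') (add_zero 1))
  obtain ⟨f₀, s, hs, hf₀⟩ := exists_finset_hom_of_extDirSumHom hT _ y
  -- `f'` and `f₀` represent the same class, so their difference extends to `P`; off `s` it has the
  -- coordinates of `f'`.
  obtain ⟨g, hg⟩ := exists_extension_of_extClass_comp_eq hT f' f₀ (hy.symm.trans hf₀.symm)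
  refine ⟨e.symm.toLinearMap ∘ₗ g.hom, s, fun x i hi => ?_⟩
  have h1 : g.hom x = f'.hom x - f₀.hom x := congrArg (fun φ => φ.hom x) hg
  have h2 : (dirSumProj (fun _ : I => A) i).hom (f₀.hom x) = 0 :=
    congrArg (fun φ => φ.hom x) (hs i hi)
  have h3 : (dirSumProj (fun _ : I => A) i).hom (g.hom x) =
      (dirSumProj (fun _ : I => A) i).hom (f'.hom x) := by
    rw [h1, map_sub, h2, sub_zero]
  rw [← he (f x) i, ← he _ i]
  exact (congrArg (fun z : DirectSum I fun _ => A => a (z i))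
    (e.apply_symm_apply (g.hom x))).trans (congrArg a h3)

/-- Dimension shifting: dimension `< 2` for `L` becomes `< 1` for the kernel. -/
theorem projective_ker_of_hasProjectiveDimensionLE_one {P L : Type u} [AddCommGroup P]
    [Module S P] [Module.Projective S P] [AddCommGroup L] [Module S L]
    (hL : HasProjectiveDimensionLE (ModuleCat.of S L) 1) (π : P →ₗ[S] L)
    (hπ : Function.Surjective π) : Module.Projective S (LinearMap.ker π) := by
  have hT := LinearMap.shortExact_shortComplexKer hπ
  have h2 : Projective π.shortComplexKer.X₂ := (IsProjective.iff_projective P).1 inferInstance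
  have := (hT.hasProjectiveDimensionLT_X₃_iff 0 h2).1 hL
  exact (IsProjective.iff_projective _).2 (projective_iff_hasProjectiveDimensionLT_one.2 this)

theorem ExtOnePreservesSumsOfCopies.isFpOmegaOne_quotient {A : ModuleCat.{u} S} (a : A ≃ₗ[S] S)
    {L : Type u} [AddCommGroup L] [Module S L]
    (hL : HasProjectiveDimensionLE (ModuleCat.of S L) 1)
    (K : Submodule S L) [Module.FinitePresentation S K]
    (h : ExtOnePreservesSumsOfCopies (ModuleCat.of S (L ⧸ K)) A) :
    IsFpOmegaOne (ModuleCat.of S (L ⧸ K)) := by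
  have hlin : Function.Surjective (Finsupp.linearCombination S (id : L → L)) :=
    Finsupp.linearCombination_id_surjective S L
  have := projective_ker_of_hasProjectiveDimensionLE_one hL _ hlin
  obtain ⟨P, _, _, _, I, j, π, hj, hex, hπ⟩ :=
    exists_projective_surjective_exact_finsupp _ hlin
  obtain ⟨f, s, hf⟩ := exists_extend_coord_off_finset j π hj hex hπ K
  let p : P →ₗ[S] L ⧸ K := K.mkQ ∘ₗ π
  have hp : Function.Surjective p := K.mkQ_surjective.comp hπ
  have hker : LinearMap.ker p = K.comap π := by
    rw [LinearMap.ker_comp, Submodule.ker_mkQ]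
  obtain ⟨g, t, hg⟩ := h.exists_extend_off_finset a (M := ModuleCat.of S (L ⧸ K)) p hp
    (f ∘ₗ (LinearEquiv.ofEq _ _ hker).toLinearMap)
  classical
  obtain ⟨P', hP', hsup, hfp⟩ :=
    -- Off `t`, `g` agrees with `f`; off `s`, `f` recovers the coordinates. Hence `s ∪ t`.
    exists_projective_sup_eq_top_inf_finitePresentation j π hj hex hπ K g (s ∪ t) (by
      intro y i hi
      rw [Finset.mem_union, not_or] at hi
      have hmem : j y ∈ LinearMap.ker p := by
        rw [hker, Submodule.mem_comap, (hex _).2 ⟨y, rfl⟩]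
        exact K.zero_mem
      rw [hg ⟨j y, hmem⟩ i hi.2]
      exact hf _ y rfl i hi.1)
  have hker' : LinearMap.ker (p ∘ₗ P'.subtype) = (K.comap π).comap P'.subtype := by
    rw [LinearMap.ker_comp, hker]
  rw [← hker'] at hfp
  refine isFpOmegaOne_of_surjective (M := ModuleCat.of S (L ⧸ K)) (p ∘ₗ P'.subtype) ?_
  intro m
  obtain ⟨x, rfl⟩ := hp m
  obtain ⟨z, hz, hxz⟩ := hsup x
  refine ⟨⟨z, hz⟩, ?_⟩
  rw [← hker, LinearMap.mem_ker, map_sub, sub_eq_zero] at hxz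
  exact hxz.symm

end ExtSums

end

/-- Right `R`-modules are modules over the opposite ring `Rᵐᵒᵖ`. -/
theorem lemma2p9 (R : Type u) [Ring R] (L : Type u) [AddCommGroup L] [Module Rᵐᵒᵖ L]
    (hL : HasProjectiveDimensionLE (ModuleCat.of Rᵐᵒᵖ L) 1)
    (K : Submodule Rᵐᵒᵖ L) (hK : Module.FinitePresentation Rᵐᵒᵖ K) :
    ExtSums.ExtOnePreservesSumsOfCopies (ModuleCat.of Rᵐᵒᵖ (L ⧸ K)) (ModuleCat.of Rᵐᵒᵖ R) ↔
      ExtSums.IsFpOmegaOne (ModuleCat.of Rᵐᵒᵖ (L ⧸ K)) := by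
  refine ⟨fun h => ?_, fun h I => h.extDirSumHom_one_bijective _⟩
  -- The right module `R` is the regular `Rᵐᵒᵖ`-module only up to isomorphism.
  exact h.isFpOmegaOne_quotient (A := ModuleCat.of Rᵐᵒᵖ R) (MulOpposite.opLinearEquiv Rᵐᵒᵖ) hL K
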